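/- Let $m\ge 1$, $n=2m$, $[k]=\{0,\dots,k-1\}$, and for $i\in[m]$ let $M_i=\{(\ell,\,m+((i+\ell)\bmod m)) : \ell\in[m]\}$, a perfect matching between $\{0,\dots,m-1\}$ and $\{m,\dots,2m-1\}$. For a gadget $g:\{0,1\}^n\times\{0,1\}^n\to[m]$, the Gadgeted Hidden Matching problem $\mathrm{GHM}\circ g$ is the search problem in which, on input $x,y,z\in\{0,1\}^n$, a solution is a triple $\langle \ell,r,b\rangle\in[n]\times[n]\times\{0,1\}$ with $(\ell,r)\in M_{g(x,y)}$ and $b=z_\ell\oplus z_r$. In a (three-player) simultaneous number-on-forehead protocol, Alice sees $(y,z)$ and Bob sees $(x,z)$; each sends a single message to Charlie, who sees $(x,y)$ and the two messages and outputs a candidate solution. In a randomized protocol the messages are bit strings of fixed lengths and all players share a public random string; in a quantum protocol the messages are (unentangled) states of fixed numbers of qubits, without shared randomness, and Charlie measures them. The cost is the total number of bits, respectively qubits, sent. The protocol has error $\varepsilon$ if on every input the output is a solution with probability at least $1-\varepsilon$. For a positive integer $\alpha$, call $g$ $\alpha$-rich if for every $Q\subseteq[m]$ with $|Q|=\alpha$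 there are $S,T\subseteq\{0,1\}^n$ with $|S|=|T|=\lceil\sqrt{\alpha}\,\rceil$ and $\{g(x,y):x\in S,\ y\in T\}=Q$. Define the explicit gadget $g_m$ as follows: let $q_0<\dots<q_{k-1}$ be the elements of $\{i\in[m]:x_i=1\}$, let $u$ and $v$ be the least $j\in[m]$ with $x_{m+j}=1$, respectively $y_{m+j}=1$ (and $m$ if there is none); then $g_m(x,y)=q_{(u+v)\bmod k}$ (and $g_m(x,y)=0$ if $k=0$). **Theorem.** 1. For every $m\ge1$, the gadget $g_m$ is $\lfloor\sqrt m\rfloor$-rich. 2. There is an absolute constant $c>0$ such that for all sufficiently large $m$, every $\lfloor\sqrt m\rfloor$-rich gadget $g:\{0,1\}^n\times\{0,1\}^n\to[m]$ (in particular $g=g_m$) and every $\varepsilon<1/8$, each randomized simultaneous number-on-forehead protocol that solves $\mathrm{GHM}\circ g$ with error $\varepsilon$ has cost at least $c\,n^{1/16}$. 3. There is an absolute constant $C$ such that for every $m\ge1$ and every gadget $g:\{0,1\}^n\times\{0,1\}^n\to[m]$, there is a quantum simultaneous number-on-forehead protocol that solves $\mathrm{GHM}\circ g$ with error $0$ and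 has cost at most $C\log n$. -/

import Mathlib

open MeasureTheory

namespace SimultaneousNOF

/-- A search problem with inputs `(x, y, z)` and solutions in `Q`. -/
abbrev SearchProblem (X Y Z Q : Type) : Type := X → Y → Z → Q → Prop

/-- A randomized three-player simultaneous number-on-forehead protocol with public randomness.
Alice sees `(y, z)` and Bob sees `(x, z)`; both send one message to Charlie, who sees `(x, y)`
and produces the output. The public random string is a point of an arbitrary probability space. -/
structure RandomizedProtocol (X Y Z Q : Type) [MeasurableSpace Q] where
  /-- the space of public random strings -/
  Ω : Type
  [mΩ : MeasurableSpace Ω]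
  /-- the law of the public random string -/
  μ : Measure Ω
  [prob : IsProbabilityMeasure μ]
  /-- the length of Alice's message in bits -/
  aliceBits : ℕ
  /-- the length of Bob's message in bits -/
  bobBits : ℕ
  alice : Y → Z → Ω → (Fin aliceBits → Bool)
  bob : X → Z → Ω → (Fin bobBits → Bool)
  charlie : (Fin aliceBits → Bool) → (Fin bobBits → Bool) → X → Y → Ω → Q
  measurable_alice : ∀ y z, Measurable (alice y z)
  measurable_bob : ∀ x z, Measurable (bob x z)
  measurable_charlie : ∀ a b x y, Measurable (charlie a b x y)

namespace RandomizedProtocol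

variable {X Y Z Q : Type} [MeasurableSpace Q]

/-- Total number of bits communicated. -/
def cost (P : RandomizedProtocol X Y Z Q) : ℕ := P.aliceBits + P.bobBits

/-- Charlie's output on input `(x, y, z)` and public randomness `r`. -/
def output (P : RandomizedProtocol X Y Z Q) (x : X) (y : Y) (z : Z) (r : P.Ω) : Q :=
  P.charlie (P.alice y z r) (P.bob x z r) x y r

/-- On every input, the output is a solution with probability at least `1 - ε`. -/
def ComputesWithError (P : RandomizedProtocol X Y Z Q) (S : SearchProblem X Y Z Q)
    (ε : ℝ) : Prop :=
  letI := P.mΩ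
  ∀ x y z, 1 - ε ≤ P.μ.real {r | S x y z (P.output x y z r)}

end RandomizedProtocol

section Quantum

open scoped ComplexOrder Kronecker

/-- Mixed states of `k` qubits, as density matrices in the computational basis. -/
def IsDensityMatrix {k : ℕ} (ρ : Matrix (Fin k → Bool) (Fin k → Bool) ℂ) : Prop :=
  ρ.PosSemidef ∧ ρ.trace = 1

/-- A three-player simultaneous number-on-forehead quantum protocol, without shared entanglement
or shared randomness: Alice and Bob send quantum states to Charlie, who applies to the received
product state a measurement (POVM) that depends on his own input and is labelled by outputs. -/
structure QuantumProtocol (X Y Z Q : Type) [Fintype Q] where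
  aliceQubits : ℕ
  bobQubits : ℕ
  alice : Y → Z → Matrix (Fin aliceQubits → Bool) (Fin aliceQubits → Bool) ℂ
  bob : X → Z → Matrix (Fin bobQubits → Bool) (Fin bobQubits → Bool) ℂ
  charlie : X → Y → Q → Matrix ((Fin aliceQubits → Bool) × (Fin bobQubits → Bool))
    ((Fin aliceQubits → Bool) × (Fin bobQubits → Bool)) ℂ
  alice_state : ∀ y z, IsDensityMatrix (alice y z)
  bob_state : ∀ x z, IsDensityMatrix (bob x z)
  charlie_posSemidef : ∀ x y q, (charlie x y q).PosSemidef
  charlie_sum : ∀ x y, ∑ q, charlie x y q = 1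

namespace QuantumProtocol

variable {X Y Z Q : Type} [Fintype Q]

/-- Total number of qubits communicated. -/
def cost (P : QuantumProtocol X Y Z Q) : ℕ := P.aliceQubits + P.bobQubits

/-- The probability that Charlie outputs `q` on input `(x, y, z)` (Born rule). -/
noncomputable def outputProb (P : QuantumProtocol X Y Z Q) (x : X) (y : Y) (z : Z) (q : Q) : ℝ :=
  (P.charlie x y q * (P.alice y z ⊗ₖ P.bob x z)).trace.re

open scoped Classical in
/-- On every input, the output is a solution with probability at least `1 - ε`. -/
def ComputesWithError (P : QuantumProtocol X Y Z Q) (S : SearchProblem X Y Z Q)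
    (ε : ℝ) : Prop :=
  ∀ x y z, 1 - ε ≤ ∑ q with S x y z q, P.outputProb x y z q

end QuantumProtocol

end Quantum

/-- Bit strings of length `n`. -/
abbrev Bits (n : ℕ) : Type := Fin n → Bool

/-- Gadgets `{0,1}^n × {0,1}^n → [m]` with `n = 2 m`. -/
abbrev Gadget (m : ℕ) : Type := Bits (2 * m) → Bits (2 * m) → Fin m

/-- The perfect matching `M_i = {(ℓ, m + ((i + ℓ) mod m)) : ℓ ∈ [m]}` between
`{0, …, m-1}` and `{m, …, 2m-1}`. -/
def matching (m : ℕ) (i : Fin m) : Set (Fin (2 * m) × Fin (2 * m)) :=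
  {e | ∃ ℓ : Fin m, (e.1 : ℕ) = ℓ ∧ (e.2 : ℕ) = m + ((i : ℕ) + ℓ) % m}

/-- The possible outputs `⟨ℓ, r, b⟩`. -/
abbrev Answer (m : ℕ) : Type := Fin (2 * m) × Fin (2 * m) × Bool

/-- The Gadgeted Hidden Matching problem `GHM ∘ g`. -/
def GHM {m : ℕ} (g : Gadget m) :
    SearchProblem (Bits (2 * m)) (Bits (2 * m)) (Bits (2 * m)) (Answer m) :=
  fun x y z q => (q.1, q.2.1) ∈ matching m (g x y) ∧ q.2.2 = xor (z q.1) (z q.2.1)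

/-- `α`-rich gadgets: every `α`-element set of values is the set of values on a rectangle `S × T`
with sides `√α` (rounded up, in case `α` is not a perfect square). -/
def IsRich {m : ℕ} (α : ℕ) (g : Gadget m) : Prop :=
  ∀ Q : Finset (Fin m), Q.card = α →
    ∃ S T : Finset (Bits (2 * m)), S.card = ⌈Real.sqrt α⌉₊ ∧ T.card = ⌈Real.sqrt α⌉₊ ∧
      Finset.image₂ g S T = Q

/-- The set with indicator vector `x_0 … x_{m-1}`, listed in increasing order. -/
def firstHalf {m : ℕ} (x : Bits (2 * m)) : List (Fin m) :=
  (List.finRange m).filter fun i : Fin m => x ⟨i, by omega⟩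

/-- The position of the first `1` in `x_m … x_{2m-1}` (and `m` if there is none). -/
def offset {m : ℕ} (x : Bits (2 * m)) : ℕ :=
  (List.finRange m).findIdx fun i : Fin m => x ⟨m + i, by omega⟩

/-- An explicit gadget. The first half of `x` describes a set `{q_0 < q_1 < ⋯ < q_{k-1}} ⊆ [m]`,
the second halves of `x` and `y` describe two numbers `u` and `v`, and the value is `q_j` with
`j = (u + v) mod k` (and `0` if the set is empty). -/
def explicitGadget (m : ℕ) [NeZero m] : Gadget m := fun x y =>
  (firstHalf x).getD ((offset x + offset y) % (firstHalf x).length) 0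

end SimultaneousNOF

open SimultaneousNOF

/-! Randomized lower bound. By richness, a rectangle `S × T` of side `s` about `m^(1/4)` realizes as
its gadget values a set containing `k^3` elements of a Sidon set, where `k^6` is of order `m`. Fix
the public randomness. Alice's messages for all `y ∈ T` together with Bob's for all `x ∈ S` form one
message of `cost * s` bits that depends only on `z`, and Charlie can answer all `k^3` matching
instances from it. For a fixed value of this message the valid answers are edges of a bipartite
graph, and the Sidon property excludes 4-cycles.

For uniform `z`, a signed sum of edge parities of such a graph has exponential moment at most `exp
(4 t^2 k^4)` (`sum_exp_C4_free_le`). Edges at right vertices of low degree are treated as a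
Rademacher sum over the right bits. The others meet only about `k^2` right vertices, so the absence
of 4-cycles bounds their left degrees in square mean, and they are a Rademacher sum over the left
bits. A union bound over messages (`sum_advantage_le`) shows that an advantage of order `k^3`
requires about `k^2` bits. Hence `cost * s ≥ k^2 / 32` (`sq_le_cost_mul`), and `s ≤ 7 k^(3/2)`
leaves a cost of order `√k`.

Quantum upper bound. Alice sends the uniform superposition of the vertices with phases `(-1)^(z_j)`.
Charlie measures in the basis `(|ℓ⟩ ± |r⟩)/√2` of his matching, where the sign reveals `z_ℓ ⊕ z_r`
with certainty. -/

open SimultaneousNOF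

namespace SimultaneousNOF

/-! ### Richness of the explicit gadget. -/

/-- The string whose first half is the indicator vector of `Q` and whose second half is the
`u`-th unit vector. -/
def gadgetInput {m : ℕ} (Q : Finset (Fin m)) (u : ℕ) : Bits (2 * m) := fun k =>
  if h : (k : ℕ) < m then decide ((⟨k, h⟩ : Fin m) ∈ Q) else decide ((k : ℕ) = m + u)

lemma firstHalf_gadgetInput {m : ℕ} (Q : Finset (Fin m)) (u : ℕ) :
    firstHalf (gadgetInput Q u) = (List.finRange m).filter (fun i => decide (i ∈ Q)) := by
  simp [firstHalf, gadgetInput]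

lemma mem_firstHalf_gadgetInput {m : ℕ} (Q : Finset (Fin m)) (u : ℕ) (i : Fin m) :
    i ∈ firstHalf (gadgetInput Q u) ↔ i ∈ Q := by
  simp [firstHalf_gadgetInput]

lemma length_firstHalf_gadgetInput {m : ℕ} (Q : Finset (Fin m)) (u : ℕ) :
    (firstHalf (gadgetInput Q u)).length = Q.card := by
  have hnd : (firstHalf (gadgetInput Q u)).Nodup := (List.nodup_finRange m).filter _
  rw [← List.toFinset_card_of_nodup hnd]
  congr 1
  ext i
  simp [mem_firstHalf_gadgetInput]

lemma offset_gadgetInput {m : ℕ} (Q : Finset (Fin m)) {u : ℕ} (hu : u < m) :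
    offset (gadgetInput Q u) = u := by
  unfold offset
  rw [List.findIdx_eq (by simpa using hu)]
  refine ⟨by simp [gadgetInput], fun j hj => ?_⟩
  simp [gadgetInput]
  omega

/-- With `α = ⌊√m⌋` and `t = ⌈√α⌉ - 1`, minimality of the ceiling gives `t ≤ t^2 ≤ α - 1`, so `t (t
+ 1) ≤ 2 (α - 1) < α^2 ≤ m`. This makes room for the offsets `s * v` with `v < s`. -/
lemma pred_ceil_sqrt_mul_lt {m : ℕ} (hm : m ≠ 0) :
    (⌈√(Nat.sqrt m : ℝ)⌉₊ - 1) * ⌈√(Nat.sqrt m : ℝ)⌉₊ < m ∧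
      Nat.sqrt m ≤ ⌈√(Nat.sqrt m : ℝ)⌉₊ * ⌈√(Nat.sqrt m : ℝ)⌉₊ ∧
      1 ≤ ⌈√(Nat.sqrt m : ℝ)⌉₊ := by
  have hα : 1 ≤ Nat.sqrt m := Nat.succ_le_of_lt (Nat.sqrt_pos.2 (Nat.pos_of_ne_zero hm))
  have hαm : Nat.sqrt m * Nat.sqrt m ≤ m := Nat.sqrt_le m
  set α := Nat.sqrt m
  set s := ⌈√(α : ℝ)⌉₊ with hs
  have hs1 : 1 ≤ s := by
    apply Nat.one_le_ceil_iff.2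
    positivity
  have h1 : α ≤ s * s := by
    have : √(α : ℝ) ≤ s := Nat.le_ceil _
    have h2 := Real.sqrt_le_left (x := (α : ℝ)) (y := s) (by positivity) |>.1 this
    rw [sq] at h2
    exact_mod_cast h2
  refine ⟨?_, h1, hs1⟩
  obtain ⟨t, ht⟩ : ∃ t, s = t + 1 := ⟨s - 1, by omega⟩
  have h3 : t * t < α := by
    have : (t : ℝ) < √(α : ℝ) := Nat.lt_ceil.1 (by omega)
    have h4 := (Real.lt_sqrt (by positivity)).1 this
    rw [sq] at h4
    exact_mod_cast h4
  rw [ht, Nat.add_sub_cancel]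
  nlinarith [Nat.le_mul_self t]

/-- An index `j < α ≤ s^2` is written in base `s` as `u + s * v`; the strings in `S` supply the low
digit, those in `T` the high digit. -/
theorem isRich_explicitGadget (m : ℕ) [NeZero m] : IsRich (Nat.sqrt m) (explicitGadget m) := by
  intro Q hQ
  obtain ⟨hlt, hle, hs1⟩ := pred_ceil_sqrt_mul_lt (NeZero.ne m)
  have hα : 1 ≤ Nat.sqrt m := Nat.succ_le_of_lt (Nat.sqrt_pos.2 (Nat.pos_of_ne_zero (NeZero.ne m)))
  set s := ⌈√(Nat.sqrt m : ℝ)⌉₊ with hs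
  have hu : ∀ u < s, u < m := fun u hu => by
    have : s - 1 ≤ (s - 1) * s := Nat.le_mul_of_pos_right _ hs1
    omega
  have hv : ∀ v < s, s * v < m := fun v hv => by
    have : s * v ≤ (s - 1) * s := by
      rw [mul_comm]
      exact Nat.mul_le_mul_right _ (by omega)
    omega
  have hval : ∀ u v, u < s → v < s →
      explicitGadget m (gadgetInput Q u) (gadgetInput Q (s * v)) =
        (firstHalf (gadgetInput Q 0)).getD ((u + s * v) % Nat.sqrt m) 0 := by
    intro u v h1 h2
    simp only [explicitGadget, offset_gadgetInput Q (hu u h1), offset_gadgetInput Q (hv v h2),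
      length_firstHalf_gadgetInput, hQ]
    simp only [firstHalf_gadgetInput]
  refine ⟨(Finset.range s).image (gadgetInput Q),
    (Finset.range s).image (fun v => gadgetInput Q (s * v)), ?_, ?_, ?_⟩
  · rw [Finset.card_image_of_injOn, Finset.card_range]
    intro u h1 v h2 h
    have := congrArg offset h
    rwa [offset_gadgetInput Q (hu u (by simpa using h1)),
      offset_gadgetInput Q (hu v (by simpa using h2))] at this
  · rw [Finset.card_image_of_injOn, Finset.card_range]
    intro u h1 v h2 h
    have := congrArg offset h
    rw [offset_gadgetInput Q (hv u (by simpa using h1)),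
      offset_gadgetInput Q (hv v (by simpa using h2))] at this
    exact Nat.eq_of_mul_eq_mul_left hs1 this
  · ext i
    simp only [Finset.mem_image₂, Finset.mem_image, Finset.mem_range]
    constructor
    · rintro ⟨_, ⟨u, h1, rfl⟩, _, ⟨v, h2, rfl⟩, rfl⟩
      rw [hval u v h1 h2, ← mem_firstHalf_gadgetInput Q 0, List.getD_eq_getElem]
      · exact List.getElem_mem _
      · rw [length_firstHalf_gadgetInput, hQ]
        exact Nat.mod_lt _ hα
    · intro hi
      rw [← mem_firstHalf_gadgetInput Q 0] at hi
      obtain ⟨j, hj, rfl⟩ := List.getElem_of_mem hi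
      have hj' : j < Nat.sqrt m := by rwa [length_firstHalf_gadgetInput, hQ] at hj
      have h1 : j % s < s := Nat.mod_lt _ hs1
      have h2 : j / s < s := Nat.div_lt_of_lt_mul (by omega)
      refine ⟨_, ⟨j % s, h1, rfl⟩, _, ⟨j / s, h2, rfl⟩, ?_⟩
      rw [hval _ _ h1 h2, Nat.mod_add_div, Nat.mod_eq_of_lt hj', List.getD_eq_getElem _ _ hj]

/-! ### The zero-error quantum protocol. -/

/-- Left endpoint of the `ℓ`-th matching edge. -/
def leftVertex {m : ℕ} (ℓ : Fin m) : Fin (2 * m) := ⟨ℓ, by omega⟩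

/-- Right endpoint of the `ℓ`-th edge of the matching `M_i`. -/
def rightVertex {m : ℕ} (i ℓ : Fin m) : Fin (2 * m) :=
  ⟨m + ((i : ℕ) + ℓ) % m, by have := Nat.mod_lt (i + ℓ : ℕ) ℓ.pos; omega⟩

lemma leftVertex_injective {m : ℕ} : Function.Injective (leftVertex (m := m)) := by
  intro a b h
  simpa [leftVertex, Fin.ext_iff] using h

lemma rightVertex_injective {m : ℕ} (i : Fin m) : Function.Injective (rightVertex i) := by
  intro a b h
  have h1 : ((i : ℕ) + a) % m = ((i : ℕ) + b) % m := by simpa [rightVertex] using h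
  have h2 : (a : ℕ) ≡ b [MOD m] := Nat.ModEq.add_left_cancel' _ h1
  exact Fin.ext (h2.eq_of_lt_of_lt a.2 b.2)

lemma leftVertex_ne_rightVertex {m : ℕ} (i a b : Fin m) : leftVertex a ≠ rightVertex i b := by
  simp only [leftVertex, rightVertex, ne_eq, Fin.ext_iff]
  omega

lemma edge_mem_matching {m : ℕ} (i ℓ : Fin m) : (leftVertex ℓ, rightVertex i ℓ) ∈ matching m i :=
  ⟨ℓ, rfl, rfl⟩

lemma sum_matching_vertices {m : ℕ} {A : Type*} [AddCommMonoid A] (i : Fin m)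
    (F : Fin (2 * m) → A) :
    ∑ ℓ, (F (leftVertex ℓ) + F (rightVertex i ℓ)) = ∑ j, F j := by
  have hinj : Function.Injective (Sum.elim (leftVertex (m := m)) (rightVertex i)) :=
    leftVertex_injective.sumElim (rightVertex_injective i) (leftVertex_ne_rightVertex i)
  have hbij : Function.Bijective (Sum.elim (leftVertex (m := m)) (rightVertex i)) :=
    (Fintype.bijective_iff_injective_and_card _).2 ⟨hinj, by simp; omega⟩
  rw [Finset.sum_add_distrib, ← hbij.sum_comp, Fintype.sum_sum_type]
  rfl

/-- The sign `(-1)^b`. -/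
noncomputable def csign (b : Bool) : ℂ := if b then -1 else 1

open scoped ComplexOrder Kronecker Matrix

section Matching

variable {m k : ℕ} (f : Fin (2 * m) ↪ (Fin k → Bool))

/-- The state `(1/√n) ∑ⱼ (-1)^{zⱼ} |j⟩`. -/
noncomputable def phaseState (z : Bits (2 * m)) : (Fin k → Bool) → ℂ :=
  ∑ j, Pi.single (f j) (csign (z j) / (√(2 * m : ℝ) : ℂ))

/-- The basis vector `j` of the received register. -/
def received (j : Fin (2 * m)) : (Fin k → Bool) × (Fin 0 → Bool) := (f j, default)

/-- The vector `(|ℓ⟩ + (-1)^b |r⟩)/√2`. -/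
noncomputable def edgeVector (i ℓ : Fin m) (b : Bool) : (Fin k → Bool) × (Fin 0 → Bool) → ℂ :=
  Pi.single (received f (leftVertex ℓ)) (1 / (√2 : ℂ)) +
    Pi.single (received f (rightVertex i ℓ)) (csign b / (√2 : ℂ))

lemma received_injective : Function.Injective (received f) := fun _ _ h =>
  f.injective (congrArg Prod.fst h)

lemma phaseState_apply (z : Bits (2 * m)) (j : Fin (2 * m)) :
    phaseState f z (f j) = csign (z j) / (√(2 * m : ℝ) : ℂ) := by
  simp [phaseState, Finset.sum_apply, Pi.single_apply, f.injective.eq_iff]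

lemma ofReal_sqrt_sq {x : ℝ} (hx : 0 ≤ x) : ((√x : ℝ) : ℂ) * (√x : ℝ) = x := by
  rw [← Complex.ofReal_mul, Real.mul_self_sqrt hx]

lemma csign_mul_self (b : Bool) : csign b * csign b = 1 := by cases b <;> simp [csign]

lemma star_csign (b : Bool) : star (csign b) = csign b := by cases b <;> simp [csign]

lemma phaseState_dot (hm : 1 ≤ m) (z : Bits (2 * m)) :
    phaseState f z ⬝ᵥ star (phaseState f z) = 1 := by
  have h : ∀ v, phaseState f z v * star (phaseState f z) v =
      ∑ j, if v = f j then (1 / (2 * m : ℝ) : ℂ) else 0 := by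
    intro v
    by_cases hv : ∃ j, f j = v
    · obtain ⟨j, rfl⟩ := hv
      rw [Pi.star_apply, phaseState_apply]
      simp only [f.injective.eq_iff, Finset.sum_ite_eq, Finset.mem_univ, if_true]
      rw [star_div₀, star_csign, div_mul_div_comm, csign_mul_self]
      congr 1
      have : star ((√(2 * m : ℝ) : ℝ) : ℂ) = ((√(2 * m : ℝ) : ℝ) : ℂ) := Complex.conj_ofReal _
      rw [this, ofReal_sqrt_sq (by positivity)]
    · have h0 : phaseState f z v = 0 := by
        simp only [phaseState, Finset.sum_apply]
        refine Finset.sum_eq_zero fun j _ => ?_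
        rw [Pi.single_eq_of_ne]
        exact fun h => hv ⟨j, h.symm⟩
      rw [h0, zero_mul, Finset.sum_eq_zero]
      intro j _
      rw [if_neg]
      exact fun h => hv ⟨j, h.symm⟩
  rw [dotProduct, Finset.sum_congr rfl fun v _ => h v, Finset.sum_comm]
  have : (m : ℂ) ≠ 0 := by exact_mod_cast (by omega : m ≠ 0)
  simp
  field_simp

/-- The projection onto the basis vectors that encode no vertex. -/
noncomputable def unusedProjection :
    Matrix ((Fin k → Bool) × (Fin 0 → Bool)) ((Fin k → Bool) × (Fin 0 → Bool)) ℂ :=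
  open scoped Classical in Matrix.diagonal fun v => if v ∈ Set.range (received f) then 0 else 1

/-- The measurement for the matching `M_i`. The outcome outside the span of the vertices, which
never occurs, is reported as the answer `d`. -/
noncomputable def matchingPOVM (d : Answer m) (i : Fin m) (q : Answer m) :
    Matrix ((Fin k → Bool) × (Fin 0 → Bool)) ((Fin k → Bool) × (Fin 0 → Bool)) ℂ :=
  (∑ ℓ, ∑ b, if (leftVertex ℓ, rightVertex i ℓ, b) = q then
    Matrix.vecMulVec (edgeVector f i ℓ b) (star (edgeVector f i ℓ b)) else 0) +
    if q = d then unusedProjection f else 0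

lemma posSemidef_unusedProjection : (unusedProjection f).PosSemidef := by
  refine Matrix.PosSemidef.diagonal fun v => ?_
  simp only [Pi.zero_apply]
  split_ifs
  · exact le_rfl
  · exact zero_le_one

lemma posSemidef_edgeTerm (i ℓ : Fin m) (b : Bool) (p : Prop) [Decidable p] :
    (if p then Matrix.vecMulVec (edgeVector f i ℓ b) (star (edgeVector f i ℓ b))
      else 0).PosSemidef := by
  split_ifs
  · exact Matrix.posSemidef_vecMulVec_self_star _
  · exact Matrix.PosSemidef.zero

lemma posSemidef_matchingPOVM (d : Answer m) (i : Fin m) (q : Answer m) :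
    (matchingPOVM f d i q).PosSemidef := by
  refine Matrix.PosSemidef.add ?_ ?_
  · exact Matrix.posSemidef_sum _ fun ℓ _ => Matrix.posSemidef_sum _ fun b _ =>
      posSemidef_edgeTerm f i ℓ b _
  · split_ifs
    · exact posSemidef_unusedProjection f
    · exact Matrix.PosSemidef.zero

lemma single_mul_star_single {V : Type*} [DecidableEq V] (a v w : V) :
    (Pi.single a (1 / ((√2 : ℝ) : ℂ)) : V → ℂ) v * star ((Pi.single a (1 / ((√2 : ℝ) : ℂ)) : V → ℂ) w) =
      1 / 2 * Matrix.single a a (1 : ℂ) v w := by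
  have h2 : 1 / ((√2 : ℝ) : ℂ) * star (1 / ((√2 : ℝ) : ℂ)) = 1 / 2 := by
    have : star ((√2 : ℝ) : ℂ) = ((√2 : ℝ) : ℂ) := Complex.conj_ofReal _
    rw [star_div₀, this, star_one, div_mul_div_comm, ofReal_sqrt_sq (by norm_num)]
    norm_num
  by_cases hv : v = a
  · by_cases hw : w = a
    · subst hv hw
      simp only [Pi.single_eq_same, Matrix.single_apply_same, mul_one]
      exact h2
    · rw [Pi.single_eq_of_ne hw, Matrix.single_apply_of_ne _ _ _ _ _ (fun h => hw h.2.symm)]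
      simp
  · rw [Pi.single_eq_of_ne hv, Matrix.single_apply_of_ne _ _ _ _ _ (fun h => hv h.1.symm)]
    simp

/-- Parallelogram identity: the cross terms of the two signs cancel, leaving the projection onto the
span of the two endpoints. -/
lemma sum_edgeVector (i ℓ : Fin m) :
    ∑ b, Matrix.vecMulVec (edgeVector f i ℓ b) (star (edgeVector f i ℓ b)) =
      Matrix.single (received f (leftVertex ℓ)) (received f (leftVertex ℓ)) 1 +
        Matrix.single (received f (rightVertex i ℓ)) (received f (rightVertex i ℓ)) 1 := by
  have ht : edgeVector f i ℓ true = Pi.single (received f (leftVertex ℓ)) (1 / (√2 : ℂ)) -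
      Pi.single (received f (rightVertex i ℓ)) (1 / (√2 : ℂ)) := by
    simp [edgeVector, csign, sub_eq_add_neg, neg_div, Pi.single_neg]
  have hf : edgeVector f i ℓ false = Pi.single (received f (leftVertex ℓ)) (1 / (√2 : ℂ)) +
      Pi.single (received f (rightVertex i ℓ)) (1 / (√2 : ℂ)) := by
    simp [edgeVector, csign]
  ext v w
  have h1 := single_mul_star_single (received f (leftVertex ℓ)) v w
  have h2 := single_mul_star_single (received f (rightVertex i ℓ)) v w
  simp only [Fintype.sum_bool, Matrix.add_apply, Matrix.vecMulVec_apply, ht, hf, Pi.add_apply,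
    Pi.sub_apply, Pi.star_apply, star_sub, star_add]
  linear_combination 2 * h1 + 2 * h2

lemma sum_matchingPOVM (d : Answer m) (i : Fin m) : ∑ q, matchingPOVM f d i q = 1 := by
  simp only [matchingPOVM, Finset.sum_add_distrib]
  rw [Finset.sum_comm]
  have : ∀ ℓ : Fin m, ∑ q : Answer m, ∑ b, (if (leftVertex ℓ, rightVertex i ℓ, b) = q then
      Matrix.vecMulVec (edgeVector f i ℓ b) (star (edgeVector f i ℓ b)) else 0) =
      Matrix.single (received f (leftVertex ℓ)) (received f (leftVertex ℓ)) 1 +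
        Matrix.single (received f (rightVertex i ℓ)) (received f (rightVertex i ℓ)) 1 := by
    intro ℓ
    rw [Finset.sum_comm, ← sum_edgeVector]
    simp
  rw [Finset.sum_congr rfl fun ℓ _ => this ℓ,
    sum_matching_vertices i fun j => Matrix.single (received f j) (received f j) (1 : ℂ)]
  simp only [Finset.sum_ite_eq', Finset.mem_univ, if_true]
  ext v w
  by_cases hvw : v = w
  · subst hvw
    simp only [Matrix.add_apply, Matrix.sum_apply, Matrix.single_apply, and_self, unusedProjection,
      Matrix.diagonal_apply_eq, Matrix.one_apply_eq]
    by_cases hv : v ∈ Set.range (received f)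
    · rw [if_pos hv]
      obtain ⟨j, rfl⟩ := hv
      simp [(received_injective f).eq_iff]
    · rw [if_neg hv, Finset.sum_eq_zero, zero_add]
      intro j _
      rw [if_neg fun h => hv ⟨j, h⟩]
  · rw [Matrix.one_apply_ne hvw, Matrix.add_apply, unusedProjection,
      Matrix.diagonal_apply_ne _ hvw, Matrix.sum_apply, add_zero]
    refine Finset.sum_eq_zero fun j _ => Matrix.single_apply_of_ne _ _ _ _ _ ?_
    rintro ⟨rfl, h⟩
    exact hvw h

lemma trace_mul_vecMulVec {V : Type*} [Fintype V] (M : Matrix V V ℂ) (ψ : V → ℂ) :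
    (M * Matrix.vecMulVec ψ (star ψ)).trace = star ψ ⬝ᵥ M *ᵥ ψ := by
  rw [Matrix.mul_vecMulVec, Matrix.trace_vecMulVec, dotProduct_comm]

/-- For the correct parity the two amplitudes interfere constructively: the overlap is `±2 / √(4m)`,
with square `1 / m`. -/
lemma re_dotProduct_edgeVector (hm : 1 ≤ m) (z : Bits (2 * m)) (i ℓ : Fin m)
    (ψ : (Fin k → Bool) × (Fin 0 → Bool) → ℂ) (hψ : ∀ v, ψ v = phaseState f z v.1) :
    (star ψ ⬝ᵥ Matrix.vecMulVec
      (edgeVector f i ℓ (xor (z (leftVertex ℓ)) (z (rightVertex i ℓ))))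
      (star (edgeVector f i ℓ (xor (z (leftVertex ℓ)) (z (rightVertex i ℓ))))) *ᵥ ψ).re
      = 1 / m := by
  set b := xor (z (leftVertex ℓ)) (z (rightVertex i ℓ)) with hb
  have key : star ψ ⬝ᵥ edgeVector f i ℓ b =
      2 * csign (z (leftVertex ℓ)) / ((√2 : ℝ) * (√(2 * m : ℝ) : ℝ)) := by
    have h0 : ∀ j, star ψ (received f j) = csign (z j) / (√(2 * m : ℝ) : ℂ) := by
      intro j
      rw [Pi.star_apply, hψ, received, phaseState_apply, star_div₀, star_csign]
      congr 1
      exact Complex.conj_ofReal _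
    rw [edgeVector, dotProduct_add, dotProduct_single, dotProduct_single, h0, h0]
    have hc : csign b * csign (z (rightVertex i ℓ)) = csign (z (leftVertex ℓ)) := by
      rw [hb]
      cases z (leftVertex ℓ) <;> cases z (rightVertex i ℓ) <;> simp [csign]
    rw [div_mul_div_comm, div_mul_div_comm, mul_comm (csign (z (rightVertex i ℓ))), hc]
    ring
  have key' : star (edgeVector f i ℓ b) ⬝ᵥ ψ = star (star ψ ⬝ᵥ edgeVector f i ℓ b) := by
    exact Matrix.star_dotProduct _ _
  have hreal : star (star ψ ⬝ᵥ edgeVector f i ℓ b) = star ψ ⬝ᵥ edgeVector f i ℓ b := by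
    rw [key, ← Complex.ofReal_mul, star_div₀, star_mul', star_csign]
    congr 1
    · simp
    · exact Complex.conj_ofReal _
  rw [Matrix.vecMulVec_mulVec, dotProduct_smul, key', hreal, key, MulOpposite.smul_eq_mul_unop,
    MulOpposite.unop_op, div_mul_div_comm]
  have h1 : 2 * csign (z (leftVertex ℓ)) * (2 * csign (z (leftVertex ℓ))) = 4 := by
    linear_combination 4 * csign_mul_self (z (leftVertex ℓ))
  have h2 : ((√2 : ℝ) * (√(2 * m : ℝ) : ℝ) : ℂ) * ((√2 : ℝ) * (√(2 * m : ℝ) : ℝ) : ℂ) =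
      ((4 * m : ℝ) : ℂ) := by
    rw [mul_mul_mul_comm, ofReal_sqrt_sq (by positivity), ofReal_sqrt_sq (by positivity)]
    push_cast
    ring
  have h3 : (4 : ℂ) / ((4 * m : ℝ) : ℂ) = ((1 / m : ℝ) : ℂ) := by
    have : (m : ℂ) ≠ 0 := by exact_mod_cast (by omega : m ≠ 0)
    push_cast
    field_simp
  rw [h1, h2, h3, Complex.ofReal_re]

lemma le_re_trace_matchingPOVM (hm : 1 ≤ m) (z : Bits (2 * m)) (d : Answer m) (i ℓ : Fin m)
    (ψ : (Fin k → Bool) × (Fin 0 → Bool) → ℂ) (hψ : ∀ v, ψ v = phaseState f z v.1) :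
    1 / (m : ℝ) ≤ (star ψ ⬝ᵥ matchingPOVM f d i (leftVertex ℓ, rightVertex i ℓ,
      xor (z (leftVertex ℓ)) (z (rightVertex i ℓ))) *ᵥ ψ).re := by
  set b := xor (z (leftVertex ℓ)) (z (rightVertex i ℓ)) with hb
  have hnonneg : ∀ M : Matrix ((Fin k → Bool) × (Fin 0 → Bool)) ((Fin k → Bool) × (Fin 0 → Bool)) ℂ,
      M.PosSemidef → 0 ≤ (star ψ ⬝ᵥ M *ᵥ ψ).re := fun M hM => hM.re_dotProduct_nonneg ψ
  have hterm := re_dotProduct_edgeVector f hm z i ℓ ψ hψ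
  rw [← hb] at hterm
  rw [← hterm, matchingPOVM, Matrix.add_mulVec, dotProduct_add, Complex.add_re, Matrix.sum_mulVec,
    dotProduct_sum, Complex.re_sum]
  refine le_add_of_le_of_nonneg (le_trans ?_ (Finset.single_le_sum
    (fun ℓ' _ => hnonneg _ (Matrix.posSemidef_sum _ fun b _ => posSemidef_edgeTerm f i ℓ' b _))
    (Finset.mem_univ ℓ))) (hnonneg _ ?_)
  · rw [Matrix.sum_mulVec, dotProduct_sum, Complex.re_sum]
    refine le_trans ?_ (Finset.single_le_sum
      (fun b' _ => hnonneg _ (posSemidef_edgeTerm f i ℓ b' _)) (Finset.mem_univ b))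
    rw [if_pos rfl]
  · split_ifs
    · exact posSemidef_unusedProjection f
    · exact Matrix.PosSemidef.zero

/-- Each of the `m` edges with its correct parity has probability at least `1 / m`, so correct
answers exhaust the total mass and no wrong outcome needs to be examined. Bob sends zero qubits. -/
theorem exists_quantumProtocol (hm : 1 ≤ m) (g : Gadget m) :
    ∃ P : QuantumProtocol (Bits (2 * m)) (Bits (2 * m)) (Bits (2 * m)) (Answer m),
      P.ComputesWithError (GHM g) 0 ∧ P.cost = Nat.clog 2 (2 * m) := by
  obtain ⟨f⟩ : Nonempty (Fin (2 * m) ↪ (Fin (Nat.clog 2 (2 * m)) → Bool)) := by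
    rw [Function.Embedding.nonempty_iff_card_le]
    simpa using Nat.le_pow_clog (by norm_num) _
  have h0 : 0 < 2 * m := by omega
  let P : QuantumProtocol (Bits (2 * m)) (Bits (2 * m)) (Bits (2 * m)) (Answer m) :=
    { aliceQubits := Nat.clog 2 (2 * m)
      bobQubits := 0
      alice := fun _ z => Matrix.vecMulVec (phaseState f z) (star (phaseState f z))
      bob := fun _ _ => 1
      charlie := fun x y => matchingPOVM f (⟨0, h0⟩, ⟨0, h0⟩, true) (g x y)
      alice_state := fun _ z => ⟨Matrix.posSemidef_vecMulVec_self_star _, by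
        rw [Matrix.trace_vecMulVec, phaseState_dot f hm]⟩
      bob_state := fun _ _ => ⟨Matrix.PosSemidef.one, by simp [Matrix.trace_one]⟩
      charlie_posSemidef := fun x y q => posSemidef_matchingPOVM f _ _ _
      charlie_sum := fun x y => sum_matchingPOVM f _ _ }
  refine ⟨P, fun x y z => ?_, by simp [P, QuantumProtocol.cost]⟩
  set ψ : (Fin (Nat.clog 2 (2 * m)) → Bool) × (Fin 0 → Bool) → ℂ :=
    fun v => phaseState f z v.1 with hψ
  have hρ : P.alice y z ⊗ₖ P.bob x z = Matrix.vecMulVec ψ (star ψ) := by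
    ext v w
    have h1 : (1 : Matrix (Fin 0 → Bool) (Fin 0 → Bool) ℂ) v.2 w.2 = 1 :=
      (congrArg _ (Subsingleton.elim w.2 v.2)).trans (Matrix.one_apply_eq _)
    change phaseState f z v.1 * star (phaseState f z w.1) *
      (1 : Matrix (Fin 0 → Bool) (Fin 0 → Bool) ℂ) v.2 w.2 = _
    rw [h1, mul_one]
    rfl
  have hprob : ∀ q, P.outputProb x y z q =
      (star ψ ⬝ᵥ matchingPOVM f (⟨0, h0⟩, ⟨0, h0⟩, true) (g x y) q *ᵥ ψ).re := by
    intro q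
    rw [QuantumProtocol.outputProb, hρ, trace_mul_vecMulVec]
  let sol : Fin m → Answer m := fun ℓ => (leftVertex ℓ, rightVertex (g x y) ℓ,
    xor (z (leftVertex ℓ)) (z (rightVertex (g x y) ℓ)))
  have hsol : Function.Injective sol := fun a b h =>
    leftVertex_injective (congrArg Prod.fst h)
  classical
  calc (1 : ℝ) - 0 = ∑ _ℓ : Fin m, 1 / (m : ℝ) := by
        have : (m : ℝ) ≠ 0 := by exact_mod_cast (by omega : m ≠ 0)
        simp [this]
    _ ≤ ∑ ℓ, P.outputProb x y z (sol ℓ) := Finset.sum_le_sum fun ℓ _ => by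
        rw [hprob]
        exact le_re_trace_matchingPOVM f hm z _ (g x y) ℓ ψ fun _ => rfl
    _ = ∑ q ∈ Finset.univ.image sol, P.outputProb x y z q :=
        (Finset.sum_image fun a _ b _ h => hsol h).symm
    _ ≤ _ := by
        refine Finset.sum_le_sum_of_subset_of_nonneg ?_ fun q _ _ => ?_
        · intro q hq
          obtain ⟨ℓ, -, rfl⟩ := Finset.mem_image.1 hq
          exact Finset.mem_filter.2 ⟨Finset.mem_univ _, edge_mem_matching _ _, rfl⟩
        · rw [hprob]
          exact (posSemidef_matchingPOVM f _ _ _).re_dotProduct_nonneg ψ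

end Matching

lemma clog_two_le_log {n : ℕ} (hn : 2 ≤ n) : (Nat.clog 2 n : ℝ) ≤ 2 / Real.log 2 * Real.log n := by
  have h2 : 0 < Real.log 2 := Real.log_pos (by norm_num)
  have h1 : Nat.clog 2 n ≤ Nat.log 2 n + 1 := Nat.clog_le_of_le_pow (Nat.lt_pow_succ_log_self (by norm_num) n).le
  have h3 : 1 ≤ Nat.log 2 n := Nat.log_pos (by norm_num) hn
  have h4 : (Nat.log 2 n : ℝ) * Real.log 2 ≤ Real.log n := by
    rw [← Real.log_pow]
    refine Real.log_le_log (by positivity) ?_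
    exact_mod_cast Nat.pow_log_le_self 2 (by omega)
  have h5 : (Nat.clog 2 n : ℝ) ≤ 2 * Nat.log 2 n := by exact_mod_cast (by omega)
  rw [div_mul_eq_mul_div, le_div_iff₀ h2]
  nlinarith

/-! ### Exponential moments of edge parities. -/

/-- The sign `(-1)^b`. -/
def sgn (b : Bool) : ℝ := if b then -1 else 1

lemma abs_sgn (b : Bool) : |sgn b| = 1 := by cases b <;> simp [sgn]

section ExponentialMoment

variable {L R ι : Type*} [Fintype L] [Fintype R] [DecidableEq L] [DecidableEq R]

/-- Hoeffding's argument: the sum factors over the coordinates, and `cosh x ≤ exp (x^2 / 2)`. -/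
lemma sum_exp_sum_sgn_le (c : R → ℝ) :
    ∑ q : R → Bool, Real.exp (∑ r, sgn (q r) * c r) ≤
      2 ^ Fintype.card R * Real.exp ((∑ r, c r ^ 2) / 2) := by
  have h1 : ∑ q : R → Bool, Real.exp (∑ r, sgn (q r) * c r) = ∏ r, (2 * Real.cosh (c r)) := by
    simp_rw [Real.exp_sum]
    rw [← Fintype.prod_sum (fun r b => Real.exp (sgn b * c r))]
    refine Finset.prod_congr rfl fun r _ => ?_
    rw [Fintype.sum_bool, Real.cosh_eq]
    simp [sgn]
    ring
  rw [h1, Finset.prod_mul_distrib, Finset.prod_const, Finset.card_univ, Finset.sum_div, Real.exp_sum]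
  gcongr with r
  exact Real.cosh_le_exp_half_sq _

/-- For a family of edges of a bipartite graph, the exponential moment of a signed sum of edge
parities is controlled by the right degrees. -/
lemma sum_exp_edges_le (E : Finset ι) (a : ι → L) (b : ι → R) (σ : ι → ℝ)
    (hσ : ∀ i, |σ i| ≤ 1) (t : ℝ) :
    ∑ p : L → Bool, ∑ q : R → Bool,
      Real.exp (t * ∑ i ∈ E, σ i * (sgn (p (a i)) * sgn (q (b i)))) ≤
      2 ^ Fintype.card L * 2 ^ Fintype.card R *
        Real.exp (t ^ 2 * (∑ r, ((E.filter fun i => b i = r).card : ℝ) ^ 2) / 2) := by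
  have key : ∀ p : L → Bool, ∑ q : R → Bool,
      Real.exp (t * ∑ i ∈ E, σ i * (sgn (p (a i)) * sgn (q (b i)))) ≤
      2 ^ Fintype.card R *
        Real.exp (t ^ 2 * (∑ r, ((E.filter fun i => b i = r).card : ℝ) ^ 2) / 2) := by
    intro p
    -- For fixed `p` this is a Rademacher sum in `q`; the coefficient at `r` is at most `|t|` times
    -- the degree of `r`.
    set c : R → ℝ := fun r => t * ∑ i ∈ E.filter (fun i => b i = r), σ i * sgn (p (a i)) with hc
    have h1 : ∀ q : R → Bool, t * ∑ i ∈ E, σ i * (sgn (p (a i)) * sgn (q (b i))) =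
        ∑ r, sgn (q r) * c r := by
      intro q
      rw [← Finset.sum_fiberwise E b fun i => σ i * (sgn (p (a i)) * sgn (q (b i))),
        Finset.mul_sum]
      refine Finset.sum_congr rfl fun r _ => ?_
      simp only [hc]
      rw [mul_left_comm, Finset.mul_sum (a := sgn (q r))]
      congr 1
      refine Finset.sum_congr rfl fun i hi => ?_
      rw [(Finset.mem_filter.1 hi).2]
      ring
    simp_rw [h1]
    refine (sum_exp_sum_sgn_le c).trans ?_
    gcongr
    rw [Finset.mul_sum]
    refine Finset.sum_le_sum fun r _ => ?_
    rw [hc, mul_pow]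
    refine mul_le_mul_of_nonneg_left ?_ (sq_nonneg t)
    refine sq_le_sq' ?_ ?_ <;> [apply neg_le_of_abs_le; apply le_of_abs_le] <;>
    · refine (Finset.abs_sum_le_sum_abs _ _).trans ?_
      refine (Finset.sum_le_card_nsmul _ _ 1 fun i _ => ?_).trans (by simp)
      rw [abs_mul, abs_sgn, mul_one]
      exact hσ i
  refine (Finset.sum_le_sum fun p _ => key p).trans ?_
  rw [Finset.sum_const, Finset.card_univ, Fintype.card_fun, Fintype.card_bool, nsmul_eq_mul]
  push_cast
  rw [mul_assoc]

/-- The edges with a right endpoint of degree at most `k`. -/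
def lowEdges (E : Finset ι) (b : ι → R) (k : ℕ) : Finset ι :=
  E.filter fun i => (E.filter fun j => b j = b i).card ≤ k

/-- The edges with a right endpoint of degree larger than `k`. -/
def highEdges (E : Finset ι) (b : ι → R) (k : ℕ) : Finset ι :=
  E.filter fun i => ¬ (E.filter fun j => b j = b i).card ≤ k

/-- A nonzero degree among low edges is at most `k`, so its square is at most `k` times the degree,
and degrees sum to the number of edges. -/
lemma sum_sq_lowEdges_le (E : Finset ι) (b : ι → R) (k : ℕ) :
    ∑ r, ((lowEdges E b k).filter fun i => b i = r).card ^ 2 ≤ k * E.card := by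
  have h1 : ∀ r, ((lowEdges E b k).filter fun i => b i = r).card ^ 2 ≤
      k * (E.filter fun i => b i = r).card := by
    intro r
    have h2 : ((lowEdges E b k).filter fun i => b i = r).card ≤ (E.filter fun i => b i = r).card :=
      Finset.card_le_card (Finset.filter_subset_filter _ (Finset.filter_subset _ _))
    rcases Finset.eq_empty_or_nonempty ((lowEdges E b k).filter fun i => b i = r) with h | ⟨i, hi⟩
    · simp [h]
    · simp only [lowEdges, Finset.mem_filter] at hi
      rw [hi.2] at hi
      rw [sq]
      exact Nat.mul_le_mul (h2.trans hi.1.2) h2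
  refine (Finset.sum_le_sum fun r _ => h1 r).trans ?_
  rw [← Finset.mul_sum, ← Finset.card_eq_sum_card_fiberwise (fun i _ => Finset.mem_univ (b i))]

/-- The sum of squares counts ordered pairs of edges with a common left endpoint. Diagonal pairs
number at most `E.card`. By `hC4`, which excludes 4-cycles and parallel edges, an off-diagonal pair
is determined by its two right endpoints, and at most `h` right vertices have degree above `k`. -/
lemma sum_sq_highEdges_le [DecidableEq ι] (E : Finset ι) (a : ι → L) (b : ι → R) {k h : ℕ}
    (hk : E.card ≤ k * h) (hk0 : 0 < k)
    (hC4 : ∀ i ∈ E, ∀ j ∈ E, ∀ i' ∈ E, ∀ j' ∈ E, a i = a j → a i' = a j' → b i = b i' →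
      b j = b j' → i ≠ j → i = i' ∧ j = j') :
    ∑ l, ((highEdges E b k).filter fun i => a i = l).card ^ 2 ≤ h ^ 2 + E.card := by
  set H := highEdges E b k with hH
  have hHE : H ⊆ E := Finset.filter_subset _ _
  have hcard : (H.image b).card ≤ h := by
    have h1 : (H.image b).card * k ≤ E.card := by
      rw [Finset.card_eq_sum_card_fiberwise (fun i _ => Finset.mem_univ (b i)), ← smul_eq_mul]
      refine (Finset.card_nsmul_le_sum (H.image b) (fun r => (E.filter fun i => b i = r).card) k ?_).trans
        (Finset.sum_le_sum_of_subset (Finset.subset_univ _))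
      intro r hr
      obtain ⟨i, hi, rfl⟩ := Finset.mem_image.1 hr
      simp only [hH, highEdges, Finset.mem_filter, not_le] at hi
      exact hi.2.le
    exact Nat.le_of_mul_le_mul_right (h1.trans (by rwa [mul_comm h])) hk0
  set D := (H ×ˢ H).filter fun x => a x.1 = a x.2 with hD
  have hsum : ∑ l, (H.filter fun i => a i = l).card ^ 2 = D.card := by
    rw [Finset.card_eq_sum_card_fiberwise (f := fun x => a x.1) (t := Finset.univ)
      (fun i _ => Finset.mem_univ _)]
    refine Finset.sum_congr rfl fun l _ => ?_
    rw [sq, ← Finset.card_product]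
    congr 1
    ext x
    simp only [hD, Finset.mem_filter, Finset.mem_product]
    constructor
    · rintro ⟨⟨h1, h2⟩, h3, h4⟩
      exact ⟨⟨⟨h1, h3⟩, h2.trans h4.symm⟩, h2⟩
    · rintro ⟨⟨⟨h1, h3⟩, h4⟩, h2⟩
      exact ⟨⟨h1, h2⟩, h3, h4 ▸ h2⟩
  rw [hsum, ← Finset.card_filter_add_card_filter_not (fun x : ι × ι => x.1 ≠ x.2)]
  refine Nat.add_le_add ?_ ?_
  · have h1 : (D.filter fun x => x.1 ≠ x.2).card ≤ (H.image b ×ˢ H.image b).card := by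
      refine Finset.card_le_card_of_injOn (fun x => (b x.1, b x.2)) ?_ ?_
      · intro x hx
        simp only [hD, Finset.coe_filter, Finset.mem_filter, Finset.mem_product,
          Set.mem_ofPred_eq] at hx
        exact Finset.mem_coe.2 (Finset.mk_mem_product (Finset.mem_image_of_mem _ hx.1.1.1)
          (Finset.mem_image_of_mem _ hx.1.1.2))
      · intro x hx y hy hxy
        simp only [hD, Finset.coe_filter, Finset.mem_filter, Finset.mem_product,
          Set.mem_ofPred_eq] at hx hy
        obtain ⟨h1, h2⟩ := Prod.mk.inj hxy
        exact Prod.ext_iff.2 (hC4 _ (hHE hx.1.1.1) _ (hHE hx.1.1.2) _ (hHE hy.1.1.1) _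
          (hHE hy.1.1.2) hx.1.2 hy.1.2 h1 h2 hx.2)
    refine h1.trans ?_
    rw [Finset.card_product, sq]
    exact Nat.mul_le_mul hcard hcard
  · refine Finset.card_le_card_of_injOn Prod.fst ?_ ?_
    · intro x hx
      simp only [hD, Finset.coe_filter, Finset.mem_filter, Finset.mem_product,
          Set.mem_ofPred_eq] at hx
      exact hHE hx.1.1.1
    · intro x hx y hy hxy
      simp only [Finset.coe_filter, Set.mem_ofPred_eq, not_not] at hx hy
      exact Prod.ext hxy (by rw [← hx.2, ← hy.2, hxy])

/-- Exponential moment bound for the edge parities of a bipartite graph without 4-cycles. -/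
lemma sum_exp_C4_free_le [DecidableEq ι] (E : Finset ι) (a : ι → L) (b : ι → R) (σ : ι → ℝ)
    (hσ : ∀ i, |σ i| ≤ 1) {k : ℕ} (hk0 : 0 < k) (hE : E.card ≤ k ^ 3)
    (hC4 : ∀ i ∈ E, ∀ j ∈ E, ∀ i' ∈ E, ∀ j' ∈ E, a i = a j → a i' = a j' → b i = b i' →
      b j = b j' → i ≠ j → i = i' ∧ j = j') (t : ℝ) :
    ∑ p : L → Bool, ∑ q : R → Bool,
      Real.exp (t * ∑ i ∈ E, σ i * (sgn (p (a i)) * sgn (q (b i)))) ≤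
      2 ^ Fintype.card L * 2 ^ Fintype.card R * Real.exp (4 * t ^ 2 * k ^ 4) := by
  have hlow := sum_exp_edges_le (lowEdges E b k) a b σ hσ (2 * t)
  have hhigh := sum_exp_edges_le (highEdges E b k) b a σ hσ (2 * t)
  have hlow2 : ∑ r, (((lowEdges E b k).filter fun i => b i = r).card : ℝ) ^ 2 ≤ 2 * (k : ℝ) ^ 4 := by
    have h1 := sum_sq_lowEdges_le E b k
    have h2 : k * E.card ≤ 2 * k ^ 4 := by nlinarith [Nat.mul_le_mul_left k hE]
    exact_mod_cast h1.trans h2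
  have hhigh2 : ∑ l, (((highEdges E b k).filter fun i => a i = l).card : ℝ) ^ 2 ≤
      2 * (k : ℝ) ^ 4 := by
    have h1 := sum_sq_highEdges_le E a b (k := k) (h := k ^ 2) (by rw [← pow_succ']; exact hE) hk0 hC4
    have h2 : (k ^ 2) ^ 2 + E.card ≤ 2 * k ^ 4 := by
      have : k ^ 3 ≤ k ^ 4 := Nat.pow_le_pow_right hk0 (by norm_num)
      have h4 : (k ^ 2) ^ 2 = k ^ 4 := by ring
      omega
    exact_mod_cast h1.trans h2
  have hexp : ∀ S : ℝ, S ≤ 2 * (k : ℝ) ^ 4 →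
      Real.exp ((2 * t) ^ 2 * S / 2) ≤ Real.exp (4 * t ^ 2 * k ^ 4) := by
    intro S hS
    gcongr
    nlinarith [mul_le_mul_of_nonneg_left hS (sq_nonneg t)]
  have hlow3 := hlow.trans (mul_le_mul_of_nonneg_left (hexp _ hlow2) (by positivity))
  have hhigh3 := hhigh.trans (mul_le_mul_of_nonneg_left (hexp _ hhigh2) (by positivity))
  rw [Finset.sum_comm] at hhigh3
  -- AM-GM decouples the low and high parts at the price of doubling `t`.
  have hpt : ∀ (p : L → Bool) (q : R → Bool),
      Real.exp (t * ∑ i ∈ E, σ i * (sgn (p (a i)) * sgn (q (b i)))) ≤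
        (Real.exp (2 * t * ∑ i ∈ lowEdges E b k, σ i * (sgn (p (a i)) * sgn (q (b i)))) +
        Real.exp (2 * t * ∑ i ∈ highEdges E b k, σ i * (sgn (q (b i)) * sgn (p (a i))))) / 2 := by
    intro p q
    have hs : ∑ i ∈ E, σ i * (sgn (p (a i)) * sgn (q (b i))) =
        ∑ i ∈ lowEdges E b k, σ i * (sgn (p (a i)) * sgn (q (b i))) +
        ∑ i ∈ highEdges E b k, σ i * (sgn (q (b i)) * sgn (p (a i))) := by
      simp_rw [mul_comm (sgn (q (b _)))]
      exact (Finset.sum_filter_add_sum_filter_not E _ _).symm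
    rw [hs]
    set A := ∑ i ∈ lowEdges E b k, σ i * (sgn (p (a i)) * sgn (q (b i)))
    set B := ∑ i ∈ highEdges E b k, σ i * (sgn (q (b i)) * sgn (p (a i)))
    have e1 : Real.exp (t * (A + B)) = Real.exp (t * A) * Real.exp (t * B) := by
      rw [← Real.exp_add]; ring_nf
    have e2 : Real.exp (2 * t * A) = Real.exp (t * A) ^ 2 := by
      rw [← Real.exp_nat_mul]; ring_nf
    have e3 : Real.exp (2 * t * B) = Real.exp (t * B) ^ 2 := by
      rw [← Real.exp_nat_mul]; ring_nf
    rw [e1, e2, e3]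
    nlinarith [sq_nonneg (Real.exp (t * A) - Real.exp (t * B))]
  refine (Finset.sum_le_sum fun p _ => Finset.sum_le_sum fun q _ => hpt p q).trans ?_
  simp_rw [← Finset.sum_div, Finset.sum_add_distrib]
  linarith

/-- A message from a set `M` about `(p, q)` predicts few edge parities: the expected advantage is
bounded in terms of `log |M|`. -/
lemma sum_advantage_le [DecidableEq ι] {M : Type*} [Fintype M] [DecidableEq M]
    (Φ : (L → Bool) → (R → Bool) → M)
    (E : M → Finset ι) (a : M → ι → L) (b : M → ι → R) (σ : M → ι → ℝ)
    (hσ : ∀ μ i, |σ μ i| ≤ 1) {k : ℕ} (hk0 : 0 < k) (hE : ∀ μ, (E μ).card ≤ k ^ 3)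
    (hC4 : ∀ μ, ∀ i ∈ E μ, ∀ j ∈ E μ, ∀ i' ∈ E μ, ∀ j' ∈ E μ, a μ i = a μ j → a μ i' = a μ j' →
      b μ i = b μ i' → b μ j = b μ j' → i ≠ j → i = i' ∧ j = j') (t : ℝ) :
    ∑ p : L → Bool, ∑ q : R → Bool,
      t * ∑ i ∈ E (Φ p q), σ (Φ p q) i * (sgn (p (a (Φ p q) i)) * sgn (q (b (Φ p q) i))) ≤
      2 ^ Fintype.card L * 2 ^ Fintype.card R *
        (Real.log (Fintype.card M) + 4 * t ^ 2 * k ^ 4) := by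
  set W : M → (L → Bool) → (R → Bool) → ℝ := fun μ p q =>
    t * ∑ i ∈ E μ, σ μ i * (sgn (p (a μ i)) * sgn (q (b μ i))) with hW
  have hM : 0 < (Fintype.card M : ℝ) := by
    have : Nonempty M := ⟨Φ (fun _ => true) (fun _ => true)⟩
    exact_mod_cast Fintype.card_pos
  set A := Real.log (Fintype.card M) + 4 * t ^ 2 * k ^ 4 with hA
  have hexpA : Real.exp A = Fintype.card M * Real.exp (4 * t ^ 2 * k ^ 4) := by
    rw [hA, Real.exp_add, Real.exp_log hM]
  have hN : ∑ p : L → Bool, ∑ q : R → Bool, (1 : ℝ) = 2 ^ Fintype.card L * 2 ^ Fintype.card R := by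
    simp
  have htot : ∑ p : L → Bool, ∑ q : R → Bool, Real.exp (W (Φ p q) p q) ≤
      2 ^ Fintype.card L * 2 ^ Fintype.card R * Real.exp A := by
    calc _ ≤ ∑ p : L → Bool, ∑ q : R → Bool, ∑ μ, Real.exp (W μ p q) := by
          refine Finset.sum_le_sum fun p _ => Finset.sum_le_sum fun q _ => ?_
          exact Finset.single_le_sum (f := fun μ => Real.exp (W μ p q))
            (fun μ _ => (Real.exp_pos _).le) (Finset.mem_univ (Φ p q))
      _ = ∑ μ, ∑ p : L → Bool, ∑ q : R → Bool, Real.exp (W μ p q) := by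
          simp_rw [Finset.sum_comm (t := (Finset.univ : Finset M))]
      _ ≤ ∑ _μ : M, 2 ^ Fintype.card L * 2 ^ Fintype.card R * Real.exp (4 * t ^ 2 * k ^ 4) :=
          Finset.sum_le_sum fun μ _ =>
            sum_exp_C4_free_le (E μ) (a μ) (b μ) (σ μ) (hσ μ) hk0 (hE μ) (hC4 μ) t
      _ = _ := by
          rw [Finset.sum_const, Finset.card_univ, nsmul_eq_mul, hexpA]
          ring
  -- The tangent line `x + 1 ≤ exp x` at `x = W - A` replaces Jensen's inequality: after averaging,
  -- the exponential term is at most `1`.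
  have hpt : ∀ p q, W (Φ p q) p q ≤ (A - 1) * 1 + Real.exp (W (Φ p q) p q) * Real.exp (-A) := by
    intro p q
    have := Real.add_one_le_exp (W (Φ p q) p q - A)
    rw [sub_eq_add_neg, Real.exp_add] at this
    linarith
  refine (Finset.sum_le_sum fun p _ => Finset.sum_le_sum fun q _ => hpt p q).trans ?_
  simp_rw [Finset.sum_add_distrib, ← Finset.mul_sum, ← Finset.sum_mul]
  rw [hN]
  have := mul_le_mul_of_nonneg_right htot (Real.exp_pos (-A)).le
  rw [mul_assoc _ (Real.exp A), ← Real.exp_add, add_neg_cancel, Real.exp_zero, mul_one] at this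
  linarith

end ExponentialMoment

/-! ### A Sidon set. -/

/-- The Erdős–Turán Sidon sequence. -/
def sidon (p t : ℕ) : ℕ := 2 * p * t + t ^ 2 % p

/-- The factor `2` keeps sums of two terms below `4 * p ^ 2 ≤ m`, so that congruences modulo `m`
between such sums become equalities. -/
lemma sidon_lt {p t : ℕ} (ht : t < p) : 2 * sidon p t < 4 * p ^ 2 := by
  have := Nat.mod_lt (t ^ 2) (by omega : 0 < p)
  unfold sidon
  nlinarith

lemma sidon_injective {p : ℕ} (hp : 0 < p) : Function.Injective (sidon p) := by
  have h : ∀ t, sidon p t / (2 * p) = t := by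
    intro t
    have := Nat.mod_lt (t ^ 2) hp
    rw [sidon, Nat.mul_add_div (by omega), Nat.div_eq_of_lt (by omega), add_zero]
  exact Function.LeftInverse.injective (g := fun n => n / (2 * p)) h

/-- Two residues add up to less than `2 * p`, so there is no carry: both `i + j' = i' + j` and the
same relation for squares modulo `p` follow. Eliminating `j'` gives `2 (i - j) (i - i') = 0` in
`ZMod p`. -/
lemma sidon_add_eq {p : ℕ} [hp : Fact p.Prime] (hp2 : p ≠ 2) {i j i' j' : ℕ} (hi : i < p)
    (hj : j < p) (hi' : i' < p)
    (h : sidon p i + sidon p j' = sidon p i' + sidon p j) : i = j ∨ i = i' := by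
  have hp0 : 0 < p := hp.out.pos
  unfold sidon at h
  have l1 := Nat.mod_lt (i ^ 2) hp0
  have l2 := Nat.mod_lt (j ^ 2) hp0
  have l3 := Nat.mod_lt (i' ^ 2) hp0
  have l4 := Nat.mod_lt (j' ^ 2) hp0
  have hs : i + j' = i' + j := by
    rcases lt_trichotomy (i + j') (i' + j) with h1 | h1 | h1
    · have := Nat.mul_le_mul_left (2 * p) (show i + j' + 1 ≤ i' + j from h1)
      simp only [mul_add, mul_one] at this
      omega
    · exact h1
    · have := Nat.mul_le_mul_left (2 * p) (show i' + j + 1 ≤ i + j' from h1)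
      simp only [mul_add, mul_one] at this
      omega
  have hq : i ^ 2 % p + j' ^ 2 % p = i' ^ 2 % p + j ^ 2 % p := by nlinarith
  have hsZ : (i : ZMod p) + j' = i' + j := by exact_mod_cast congrArg (Nat.cast (R := ZMod p)) hs
  have hqZ : (i : ZMod p) ^ 2 + j' ^ 2 = i' ^ 2 + j ^ 2 := by
    have := congrArg (Nat.cast (R := ZMod p)) hq
    push_cast [ZMod.natCast_mod] at this
    exact this
  have h2 : (2 : ZMod p) ≠ 0 := by
    intro h0
    have : (p : ℕ) ∣ 2 := (ZMod.natCast_eq_zero_iff 2 p).1 (by exact_mod_cast h0)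
    exact hp2 ((Nat.prime_dvd_prime_iff_eq hp.out Nat.prime_two).1 this)
  have hprod : 2 * (((i : ZMod p) - j) * (i - i')) = 0 := by
    have : (j' : ZMod p) = i' + j - i := by linear_combination hsZ
    rw [this] at hqZ
    linear_combination hqZ
  have hcast : ∀ {u v : ℕ}, u < p → v < p → (u : ZMod p) = v → u = v := fun hu hv huv =>
    ((ZMod.natCast_eq_natCast_iff _ _ _).1 huv).eq_of_lt_of_lt hu hv
  rcases mul_eq_zero.1 ((mul_eq_zero.1 hprod).resolve_left h2) with h3 | h3
  · exact Or.inl (hcast hi hj (sub_eq_zero.1 h3))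
  · exact Or.inr (hcast hi hi' (sub_eq_zero.1 h3))

/-! ### From answers for a Sidon set of matchings to a graph without 4-cycles. -/

/-- Concatenation of the two halves of `z`. -/
def joinHalves {m : ℕ} (p q : Fin m → Bool) : Bits (2 * m) := fun v =>
  if h : (v : ℕ) < m then p ⟨v, h⟩ else q ⟨v - m, by omega⟩

/-- Reduction of a vertex modulo `m`. -/
def half {m : ℕ} (v : Fin (2 * m)) : Fin m := ⟨v % m, Nat.mod_lt _ (by have := v.pos; omega)⟩

section Matching

variable {m : ℕ} {i : Fin m} {ℓ r : Fin (2 * m)}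

lemma joinHalves_left (h : (ℓ, r) ∈ matching m i) (p q : Fin m → Bool) :
    joinHalves p q ℓ = p (half ℓ) := by
  obtain ⟨j, h1, h2⟩ := h
  have h3 : (ℓ : ℕ) < m := h1 ▸ j.2
  simp [joinHalves, half, h3, Nat.mod_eq_of_lt h3]

lemma joinHalves_right (h : (ℓ, r) ∈ matching m i) (p q : Fin m → Bool) :
    joinHalves p q r = q (half r) := by
  obtain ⟨j, h1, h2⟩ := h
  have h3 : ¬ (r : ℕ) < m := by simp only at h2; omega
  simp only [joinHalves, half, h3, dite_false]
  congr 2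
  rw [Nat.mod_eq_sub_mod (by omega), Nat.mod_eq_of_lt (by omega)]

lemma half_right_modEq (h : (ℓ, r) ∈ matching m i) :
    (half r : ℕ) ≡ (i : ℕ) + (half ℓ : ℕ) [MOD m] := by
  obtain ⟨j, h1, h2⟩ := h
  simp only at h1 h2
  simp [half, h1, h2, Nat.ModEq]

end Matching

section Deterministic

variable {m : ℕ}

/-- If one message in `M` determines answers to the instances `i_0, i_1, …` from a Sidon set, then
the number of correct answers exceeds half of all by an amount controlled by `log |M|`. -/
lemma sum_correct_le {M : Type*} [Fintype M] [DecidableEq M] {k p : ℕ} [hp : Fact p.Prime]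
    (hk0 : 0 < k) (hp2 : p ≠ 2) (hkp : k ^ 3 < p) (hpm : 4 * p ^ 2 ≤ m)
    (i : Fin (k ^ 3) → Fin m) (hi : ∀ t, (i t : ℕ) = sidon p t)
    (Φ : Bits (2 * m) → M) (ans : M → Fin (k ^ 3) → Answer m) {lam : ℝ} (hlam : 0 ≤ lam)
    (S : Bits (2 * m) → Fin (k ^ 3) → Prop) [∀ z t, Decidable (S z t)]
    (hS : ∀ z t, S z t ↔ ((ans (Φ z) t).1, (ans (Φ z) t).2.1) ∈ matching m (i t) ∧
      (ans (Φ z) t).2.2 = xor (z (ans (Φ z) t).1) (z (ans (Φ z) t).2.1)) :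
    ∑ u : Fin m → Bool, ∑ v : Fin m → Bool,
      lam * ∑ t, (2 * (if S (joinHalves u v) t then 1 else 0) - 1) ≤
      2 ^ m * 2 ^ m * (Real.log (Fintype.card M) + 4 * lam ^ 2 * k ^ 4) := by
  classical
  set E : M → Finset (Fin (k ^ 3)) := fun μ =>
    Finset.univ.filter fun t => ((ans μ t).1, (ans μ t).2.1) ∈ matching m (i t) with hE
  have main := sum_advantage_le (L := Fin m) (R := Fin m) (fun u v => Φ (joinHalves u v)) E
    (fun μ t => half (ans μ t).1) (fun μ t => half (ans μ t).2.1)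
    (fun μ t => sgn (ans μ t).2.2) (fun μ t => (abs_sgn _).le) hk0
    (fun μ => (Finset.card_le_univ _).trans (by simp)) ?_ lam
  · rw [Fintype.card_fin] at main
    refine le_trans ?_ main
    refine Finset.sum_le_sum fun u _ => Finset.sum_le_sum fun v _ => ?_
    refine mul_le_mul_of_nonneg_left ?_ hlam
    rw [hE, Finset.sum_filter]
    refine Finset.sum_le_sum fun t _ => ?_
    set z := joinHalves u v with hz
    -- On a valid edge the score `±1` equals the claimed sign times the edge parity. An invalid edge
    -- scores `-1` and is absent from the graph, where it contributes `0`.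
    by_cases hm : ((ans (Φ z) t).1, (ans (Φ z) t).2.1) ∈ matching m (i t)
    · rw [if_pos hm, ← joinHalves_left hm u v, ← joinHalves_right hm u v, ← hz]
      have hSt := hS z t
      rw [and_iff_right hm] at hSt
      simp only [hSt]
      cases (ans (Φ z) t).2.2 <;> cases z (ans (Φ z) t).1 <;> cases z (ans (Φ z) t).2.1 <;>
        norm_num [sgn]
    · have : ¬ S z t := fun h => hm ((hS z t).1 h).1
      rw [if_neg hm, if_neg this]
      norm_num
  -- An edge of `M_i` joins residues differing by `i`, so a 4-cycle would give a relation `i₁ + i₄ ≡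
  -- i₃ + i₂` among Sidon elements.
  · intro μ t1 h1 t2 h2 t3 h3 t4 h4 ha ha' hb hb' hne
    simp only [hE, Finset.mem_filter, Finset.mem_univ, true_and] at h1 h2 h3 h4
    have e1 := half_right_modEq h1
    have e2 := half_right_modEq h2
    have e3 := half_right_modEq h3
    have e4 := half_right_modEq h4
    rw [ha, hb] at e1
    rw [hb'] at e2
    rw [ha'] at e3
    have e13 := e1.symm.trans e3
    have e42 := e4.symm.trans e2
    have hsum : (i t1 : ℕ) + i t4 ≡ i t3 + i t2 [MOD m] := by
      refine Nat.ModEq.add_right_cancel' ((half (ans μ t2).1 : ℕ) + half (ans μ t4).1) ?_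
      have := e13.add e42
      convert this using 1 <;> ring
    have hlt : ∀ t : Fin (k ^ 3), (t : ℕ) < p := fun t => t.2.trans hkp
    have hlt' : ∀ t, 2 * (i t : ℕ) < m := fun t => by
      rw [hi]
      exact (sidon_lt (hlt t)).trans_le hpm
    have heq := hsum.eq_of_lt_of_lt (by have := hlt' t1; have := hlt' t4; omega)
      (by have := hlt' t3; have := hlt' t2; omega)
    rw [hi, hi, hi, hi] at heq
    have h13 : t1 = t3 := by
      rcases sidon_add_eq hp2 (hlt t1) (hlt t2) (hlt t3) heq with h | h
      · exact absurd (Fin.ext h) hne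
      · exact Fin.ext h
    have h24 : t2 = t4 := by
      rw [h13] at heq
      exact Fin.ext (sidon_injective hp.out.pos (Nat.add_left_cancel heq).symm)
    exact ⟨h13, h24⟩

end Deterministic

/-! ### Averaging over the public randomness. -/

namespace RandomizedProtocol

variable {X Y Z Q : Type} [MeasurableSpace Q] [DiscreteMeasurableSpace Q]

/-- Charlie's output is measurable only for fixed messages, hence the decomposition over the
finitely many message pairs. -/
lemma measurableSet_solution (P : RandomizedProtocol X Y Z Q) (S : SearchProblem X Y Z Q)
    (x : X) (y : Y) (z : Z) :
    letI := P.mΩ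
    MeasurableSet {r | S x y z (P.output x y z r)} := by
  let := P.mΩ
  have : {r | S x y z (P.output x y z r)} = ⋃ a, ⋃ b, (P.alice y z ⁻¹' {a} ∩ P.bob x z ⁻¹' {b}) ∩
      P.charlie a b x y ⁻¹' {q | S x y z q} := by
    ext r
    simp [output]
  rw [this]
  refine MeasurableSet.iUnion fun a => MeasurableSet.iUnion fun b => ?_
  exact ((P.measurable_alice y z (measurableSet_singleton a)).inter
    (P.measurable_bob x z (measurableSet_singleton b))).inter
    (P.measurable_charlie a b x y (MeasurableSet.of_discrete))

/-- A bound on the number of solved instances from a finite family that holds for every value of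
the public randomness also holds in expectation. -/
lemma sum_real_solution_le (P : RandomizedProtocol X Y Z Q) (S : SearchProblem X Y Z Q)
    {J : Type*} [Fintype J] (x : J → X) (y : J → Y) (z : J → Z) (B : ℝ)
    (hB : ∀ r, open scoped Classical in
      ∑ j, (if S (x j) (y j) (z j) (P.output (x j) (y j) (z j) r) then (1 : ℝ) else 0) ≤ B) :
    letI := P.mΩ
    ∑ j, P.μ.real {r | S (x j) (y j) (z j) (P.output (x j) (y j) (z j) r)} ≤ B := by
  let := P.mΩ
  have := P.prob
  classical
  have hmeas := fun j => P.measurableSet_solution S (x j) (y j) (z j)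
  have h1 : ∀ j, P.μ.real {r | S (x j) (y j) (z j) (P.output (x j) (y j) (z j) r)} =
      ∫ r, (if S (x j) (y j) (z j) (P.output (x j) (y j) (z j) r) then (1 : ℝ) else 0) ∂P.μ := by
    intro j
    rw [← integral_indicator_one (hmeas j)]
    rfl
  have hint : ∀ j, Integrable (fun r =>
      if S (x j) (y j) (z j) (P.output (x j) (y j) (z j) r) then (1 : ℝ) else 0) P.μ := fun j =>
    (integrable_const (1 : ℝ)).indicator (hmeas j)
  simp_rw [h1]
  rw [← integral_finsetSum _ fun j _ => hint j]
  calc _ ≤ ∫ _r, B ∂P.μ := integral_mono (integrable_finsetSum _ fun j _ => hint j)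
        (integrable_const B) fun r => by
          convert hB r
    _ = B := by simp

end RandomizedProtocol

/-! ### The communication lower bound and the choice of parameters. -/

/-- Solving `GHM ∘ g` on a rectangle whose values contain a large Sidon set is expensive. -/
lemma sq_le_cost_mul {m k p s : ℕ} [hp : Fact p.Prime] (hk0 : 0 < k) (hp2 : p ≠ 2)
    (hkp : k ^ 3 < p) (hpm : 4 * p ^ 2 ≤ m) (g : Gadget m) (S T : Finset (Bits (2 * m)))
    (hS : S.card = s) (hT : T.card = s)
    (hg : ∀ t < k ^ 3, ∃ x ∈ S, ∃ y ∈ T, (g x y : ℕ) = sidon p t) {ε : ℝ} (hε : ε < 1 / 8)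
    (P : RandomizedProtocol (Bits (2 * m)) (Bits (2 * m)) (Bits (2 * m)) (Answer m))
    (hP : P.ComputesWithError (GHM g) ε) : (k : ℝ) ^ 2 / 32 ≤ P.cost * s := by
  classical
  let := P.mΩ
  choose x hx y hy hxy using fun t : Fin (k ^ 3) => hg t t.2
  have hlog2 : Real.log 2 ≤ 1 := by linarith [Real.log_two_lt_d9]
  have hk : (0 : ℝ) < k := by exact_mod_cast hk0
  -- With this choice the error term `4 * lam ^ 2 * k ^ 4` is `k ^ 2 / 64`, a third of the gain `3 /
  -- 64 * k ^ 2` from an excess `7/8 - 1/2 = 3/8` in success rate; the difference is `k ^ 2 / 32`.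
  set lam : ℝ := 1 / (16 * k) with hlam
  have hlam0 : 0 < lam := by positivity
  set A : ℝ := P.cost * s with hA
  set N : ℝ := 2 ^ m * 2 ^ m with hN
  have hN0 : 0 < N := by positivity
  -- Alice does not see `x` and Bob does not see `y`, so `s` messages from each serve all of `S ×
  -- T`.
  let M := (T → Fin P.aliceBits → Bool) × (S → Fin P.bobBits → Bool)
  have hcard : Real.log (Fintype.card M) ≤ A := by
    have h1 : Fintype.card M = 2 ^ (P.cost * s) := by
      simp only [M, Fintype.card_prod, Fintype.card_fun, Fintype.card_bool, Fintype.card_coe,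
        Fintype.card_fin, hS, hT, RandomizedProtocol.cost]
      rw [← pow_mul, ← pow_mul, ← pow_add, add_mul]
    rw [h1]
    push_cast
    rw [Real.log_pow, hA]
    push_cast
    exact mul_le_of_le_one_right (by positivity) hlog2
  set B : ℝ := N * (k ^ 3 / 2 + (A + 4 * lam ^ 2 * k ^ 4) / (2 * lam)) with hB
  have hdet := P.sum_real_solution_le (GHM g) (J := (Fin m → Bool) × (Fin m → Bool) × Fin (k ^ 3))
    (fun j => x j.2.2) (fun j => y j.2.2) (fun j => joinHalves j.1 j.2.1) B ?_
  · have hlow : ∑ _j : (Fin m → Bool) × (Fin m → Bool) × Fin (k ^ 3), (7 / 8 : ℝ) ≤ B :=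
      (Finset.sum_le_sum fun j _ => by linarith [hP (x j.2.2) (y j.2.2) (joinHalves j.1 j.2.1)]).trans
        hdet
    have hcount : ∑ _j : (Fin m → Bool) × (Fin m → Bool) × Fin (k ^ 3), (7 / 8 : ℝ) =
        N * (k ^ 3 * (7 / 8)) := by
      simp [hN]
      ring
    rw [hcount, hB] at hlow
    have h2 := le_of_mul_le_mul_left hlow hN0
    have h3 : (3 / 8 : ℝ) * k ^ 3 ≤ (A + 4 * lam ^ 2 * k ^ 4) / (2 * lam) := by linarith
    rw [le_div_iff₀ (by positivity)] at h3
    have h4 : (3 / 8 : ℝ) * k ^ 3 * (2 * lam) = 3 / 64 * k ^ 2 := by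
      rw [hlam]
      field_simp
      norm_num
    have h5 : 4 * lam ^ 2 * (k : ℝ) ^ 4 = 1 / 64 * k ^ 2 := by
      rw [hlam]
      field_simp
      norm_num
    rw [h4, h5] at h3
    linarith
  · intro r
    let Φ : Bits (2 * m) → M := fun z => (fun y => P.alice y z r, fun x => P.bob x z r)
    let ans : M → Fin (k ^ 3) → Answer m := fun μ t =>
      P.charlie (μ.1 ⟨y t, hy t⟩) (μ.2 ⟨x t, hx t⟩) (x t) (y t) r
    have main := sum_correct_le hk0 hp2 hkp hpm (fun t => g (x t) (y t)) hxy Φ ans hlam0.le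
      (fun z t => GHM g (x t) (y t) z (P.output (x t) (y t) z r)) (fun z t => Iff.rfl)
    set C : ℝ := ∑ u : Fin m → Bool, ∑ v : Fin m → Bool, ∑ t, (if GHM g (x t) (y t)
      (joinHalves u v) (P.output (x t) (y t) (joinHalves u v) r) then (1 : ℝ) else 0) with hC
    have hmain : lam * (2 * C - N * k ^ 3) ≤ N * (A + 4 * lam ^ 2 * k ^ 4) := by
      refine le_trans (le_of_eq ?_) (main.trans ?_)
      · simp_rw [Finset.sum_sub_distrib, ← Finset.mul_sum, Finset.sum_sub_distrib, ← Finset.mul_sum]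
        simp only [← hC, Finset.sum_const, Finset.card_univ, Fintype.card_fun, Fintype.card_bool,
          Fintype.card_fin, nsmul_eq_mul, hN]
        push_cast
        ring
      · rw [hN]
        gcongr
    rw [Fintype.sum_prod_type]
    simp_rw [Fintype.sum_prod_type]
    have hgoal : C ≤ B := by
      have h1 : 2 * C - N * k ^ 3 ≤ N * (A + 4 * lam ^ 2 * k ^ 4) / lam := by
        rw [le_div_iff₀ hlam0]
        linarith
      have h2 : N * (A + 4 * lam ^ 2 * k ^ 4) / lam =
          2 * (N * ((A + 4 * lam ^ 2 * k ^ 4) / (2 * lam))) := by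
        field_simp
      rw [hB, mul_add]
      linarith
    convert hgoal

/-- The factor `16` makes `4 * p ^ 2 ≤ m` for a Bertrand prime `p ≤ 2 * k ^ 3`. Maximality of `k`
and `k + 1 ≤ 2 * k` give `16 * 64 = 1024`. -/
lemma exists_pow_six_scale {m : ℕ} (hm : 16 ≤ m) :
    ∃ k : ℕ, 0 < k ∧ 16 * k ^ 6 ≤ m ∧ m < 1024 * k ^ 6 := by
  refine ⟨Nat.findGreatest (fun k => 16 * k ^ 6 ≤ m) m, ?_⟩
  have h1 : 1 ≤ Nat.findGreatest (fun k => 16 * k ^ 6 ≤ m) m :=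
    Nat.le_findGreatest (by omega) (by omega)
  have h2 : 16 * (Nat.findGreatest (fun k => 16 * k ^ 6 ≤ m) m) ^ 6 ≤ m :=
    Nat.findGreatest_spec (P := fun k => 16 * k ^ 6 ≤ m) (m := 1) (by omega) (by omega)
  set k := Nat.findGreatest (fun k => 16 * k ^ 6 ≤ m) m with hk
  refine ⟨h1, h2, ?_⟩
  have h3 : m < 16 * (k + 1) ^ 6 := by
    by_contra h
    push Not at h
    have h4 : k + 1 ≤ m := by
      have : k + 1 ≤ (k + 1) ^ 6 := Nat.le_self_pow (by norm_num) _
      omega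
    have := Nat.le_findGreatest (P := fun k => 16 * k ^ 6 ≤ m) h4 h
    omega
  have h5 : (k + 1) ^ 6 ≤ (2 * k) ^ 6 := Nat.pow_le_pow_left (by omega) 6
  rw [mul_pow] at h5
  omega

lemma ceil_sqrt_sqrt_le {m k : ℕ} (hk0 : 0 < k) (hm : m < 1024 * k ^ 6) :
    (⌈√(Nat.sqrt m : ℝ)⌉₊ : ℝ) ≤ 7 * (k * √(k : ℝ)) := by
  have hk : (1 : ℝ) ≤ k := by exact_mod_cast hk0
  have h1 : Nat.sqrt m ≤ 32 * k ^ 3 := by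
    refine (Nat.sqrt_lt.2 ?_).le
    calc m < 1024 * k ^ 6 := hm
      _ = 32 * k ^ 3 * (32 * k ^ 3) := by ring
  have h2 : √(Nat.sqrt m : ℝ) ≤ 6 * (k * √(k : ℝ)) := by
    refine Real.sqrt_le_iff.2 ⟨by positivity, ?_⟩
    rw [mul_pow, mul_pow, Real.sq_sqrt (by positivity)]
    have : (Nat.sqrt m : ℝ) ≤ 32 * k ^ 3 := by exact_mod_cast h1
    nlinarith [pow_pos (zero_lt_one.trans_le hk) 3]
  have h3 : (1 : ℝ) ≤ k * √(k : ℝ) := by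
    have := Real.one_le_sqrt.2 hk
    nlinarith
  have := Nat.ceil_lt_add_one (Real.sqrt_nonneg (Nat.sqrt m : ℝ))
  linarith

theorem rpow_le_randomized_cost {m : ℕ} (hm : 1024 ≤ m) (g : Gadget m)
    (hrich : IsRich (Nat.sqrt m) g) {ε : ℝ} (hε : ε < 1 / 8)
    (P : RandomizedProtocol (Bits (2 * m)) (Bits (2 * m)) (Bits (2 * m)) (Answer m))
    (hP : P.ComputesWithError (GHM g) ε) :
    1 / 448 * ((2 * m : ℕ) : ℝ) ^ (1 / 16 : ℝ) ≤ (P.cost : ℝ) := by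
  obtain ⟨k, hk0, hkm, hmk⟩ := exists_pow_six_scale (by omega : 16 ≤ m)
  obtain ⟨p, hp, hkp, hpk⟩ := Nat.exists_prime_lt_and_le_two_mul (k ^ 3) (by positivity)
  have : Fact p.Prime := ⟨hp⟩
  -- This is where `1024 ≤ m` enters; it forces `p > 8`, in particular `p ≠ 2`.
  have hk2 : 2 ≤ k := by
    by_contra h
    have : k = 1 := by omega
    subst this
    omega
  have h8 : 2 ^ 3 ≤ k ^ 3 := Nat.pow_le_pow_left hk2 3
  have hpm : 4 * p ^ 2 ≤ m := by
    have := Nat.pow_le_pow_left hpk 2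
    have h1 : (2 * k ^ 3) ^ 2 = 4 * k ^ 6 := by ring
    omega
  have hlt : ∀ t : Fin (k ^ 3), sidon p t < m := fun t => by
    have := sidon_lt (t.2.trans hkp)
    omega
  have hinj : Function.Injective fun t : Fin (k ^ 3) => (⟨sidon p t, hlt t⟩ : Fin m) := by
    intro t u h
    exact Fin.ext (sidon_injective hp.pos (congrArg Fin.val h))
  -- Richness concerns sets of exactly `⌊√m⌋` values, so the Sidon set is padded; the extra values
  -- are ignored.
  obtain ⟨Q, hQ, hQc⟩ := Finset.exists_superset_card_eq
    (s := Finset.univ.image fun t : Fin (k ^ 3) => (⟨sidon p t, hlt t⟩ : Fin m)) (n := Nat.sqrt m)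
    (by
      rw [Finset.card_image_of_injective _ hinj, Finset.card_univ, Fintype.card_fin, Nat.le_sqrt]
      calc k ^ 3 * k ^ 3 = k ^ 6 := by ring
        _ ≤ m := by omega)
    (by simpa using Nat.sqrt_le_self m)
  obtain ⟨S, T, hS, hT, hST⟩ := hrich Q hQc
  have hcost := sq_le_cost_mul hk0 (by omega) hkp hpm g S T hS hT (fun t ht => by
    have h1 : (⟨sidon p t, hlt ⟨t, ht⟩⟩ : Fin m) ∈ Q :=
      hQ (Finset.mem_image.2 ⟨⟨t, ht⟩, Finset.mem_univ _, rfl⟩)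
    rw [← hST] at h1
    obtain ⟨x, hx, y, hy, hxy⟩ := Finset.mem_image₂.1 h1
    exact ⟨x, hx, y, hy, by rw [hxy]⟩) hε P hP
  have hs := ceil_sqrt_sqrt_le hk0 hmk
  have hk : (0 : ℝ) < k := by exact_mod_cast hk0
  have hsk : 0 < √(k : ℝ) := Real.sqrt_pos.2 hk
  have h1 : (k : ℝ) ^ 2 / 32 ≤ P.cost * (7 * (k * √(k : ℝ))) :=
    hcost.trans (mul_le_mul_of_nonneg_left hs (Nat.cast_nonneg _))
  have h2 : √(k : ℝ) / 224 ≤ P.cost := by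
    have h3 : (k * √(k : ℝ)) * (√(k : ℝ) / 224) ≤ (k * √(k : ℝ)) * P.cost := by
      have : (k * √(k : ℝ)) * (√(k : ℝ) / 224) = k ^ 2 / 224 := by
        rw [mul_div_assoc', mul_assoc, Real.mul_self_sqrt hk.le, sq]
      rw [this]
      linarith
    exact le_of_mul_le_mul_left h3 (by positivity)
  -- Replacing `k ^ 6` by `k ^ 8` is lossy: `2 * m < 2048 * k ^ 6` would give exponent `1/12`.
  have h3 : ((2 * m : ℕ) : ℝ) ^ (1 / 16 : ℝ) ≤ 2 * √(k : ℝ) := by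
    have h4 : ((2 * m : ℕ) : ℝ) ≤ (2 * √(k : ℝ)) ^ (16 : ℕ) := by
      have h5 : (2 * √(k : ℝ)) ^ 16 = 65536 * (k : ℝ) ^ 8 := by
        rw [mul_pow, show (16 : ℕ) = 2 * 8 by norm_num, pow_mul (√(k : ℝ)), Real.sq_sqrt hk.le]
        norm_num
      have h6 : k ^ 6 ≤ k ^ 8 := Nat.pow_le_pow_right hk0 (by norm_num)
      have h7 : 2 * m ≤ 65536 * k ^ 8 := by omega
      rw [h5]
      exact_mod_cast h7
    calc _ ≤ ((2 * √(k : ℝ)) ^ (16 : ℕ)) ^ (1 / 16 : ℝ) :=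
          Real.rpow_le_rpow (Nat.cast_nonneg _) h4 (by norm_num)
      _ = 2 * √(k : ℝ) := by
          rw [← Real.rpow_natCast, ← Real.rpow_mul (by positivity)]
          norm_num
  linarith

end SimultaneousNOF

theorem theorem1 :
    -- the explicit gadget is `⌊√m⌋`-rich
    (∀ (m : ℕ) [NeZero m], IsRich (Nat.sqrt m) (explicitGadget m)) ∧
    -- randomized lower bound `Ω(n^{1/16})`, `n = 2m`, for every `⌊√m⌋`-rich gadget
    (∃ c : ℝ, 0 < c ∧ ∀ᶠ m : ℕ in Filter.atTop,
      ∀ g : Gadget m, IsRich (Nat.sqrt m) g →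
      ∀ ε : ℝ, ε < 1 / 8 →
      ∀ P : RandomizedProtocol (Bits (2 * m)) (Bits (2 * m)) (Bits (2 * m)) (Answer m),
        P.ComputesWithError (GHM g) ε →
          c * ((2 * m : ℕ) : ℝ) ^ (1 / 16 : ℝ) ≤ (P.cost : ℝ)) ∧
    -- zero-error quantum protocols with `O(log n)` qubits, for every gadget
    (∃ C : ℝ, 0 < C ∧ ∀ m : ℕ, 1 ≤ m → ∀ g : Gadget m,
      ∃ P : QuantumProtocol (Bits (2 * m)) (Bits (2 * m)) (Bits (2 * m)) (Answer m),
        P.ComputesWithError (GHM g) 0 ∧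
          (P.cost : ℝ) ≤ C * Real.log ((2 * m : ℕ) : ℝ)) := by
  refine ⟨fun m _ => isRich_explicitGadget m, ⟨1 / 448, by norm_num, ?_⟩,
    ⟨2 / Real.log 2, div_pos two_pos (Real.log_pos one_lt_two), fun m hm g => ?_⟩⟩
  · filter_upwards [Filter.eventually_ge_atTop 1024] with m hm g hg ε hε P hP
    exact rpow_le_randomized_cost hm g hg hε P hP
  · obtain ⟨P, hP, hcost⟩ := exists_quantumProtocol hm g
    refine ⟨P, hP, ?_⟩
    rw [hcost]
    exact clog_two_le_log (by omega)
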